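/- Let $a<b$ and let $f:[a,b]\to\mathbb{R}$ be four times continuously differentiable with $|f''(a)|+|f''(b)|>0$ (one-sided derivatives at the end points). For $n\ge 4$ and knots $a=x_0<x_1<\dots<x_n=b$ put $h:=\max_{1\le i\le n}(x_i-x_{i-1})$. The natural spline for $f$ on these knots is the function $s\in C^2([a,b])$ that is a polynomial of degree at most $3$ on each $[x_{i-1},x_i]$, with $s(x_i)=f(x_i)$ for $0\le i\le n$ and $s''(a)=s''(b)=0$; it exists and is unique. Its interpolation error is of the exact order $h^2$, in the following sense. (1) Upper bound: there is a constant $C>0$, depending only on $a,b,f$, such that for all $n\ge4$ and all such knots $\max_{t\in[a,b]}|s(t)-f(t)|\le C\,h^2$. (2) Lower bound: there are constants $c>0$, $h_0>0$, depending only on $a,b,f$, such that for all $n\ge 4$ and all such knots with $h\le h_0$: if $f''(a)\ne0$ then $\max_{t\in[x_0,x_1]}|s(t)-f(t)|\ge c\,(x_1-x_0)^2$, and if $f''(b)\ne 0$ then $\max_{t\in[x_{n-1},x_n]}|s(t)-f(t)|\ge c\,(x_n-x_{n-1})^2$. (3) Exact order: the worst-case error $E(h)$, that is, the supremum of $\max_{t\in[a,b]}|s(t)-f(t)|$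 over all $n\ge 4$ and all such knots with $\max_{1\le i\le n}(x_i-x_{i-1})=h$, satisfies $E(h)=\Theta(h^2)$ as $h\to0^+$. -/

import Mathlib

open Set Filter Topology Asymptotics

/-- `x 0 < x 1 < ⋯ < x n` are knots with `x 0 = a` and `x n = b`
(the values `x i` with `i > n` play no role). -/
structure IsMesh (a b : ℝ) (n : ℕ) (x : ℕ → ℝ) : Prop where
  left : x 0 = a
  right : x n = b
  lt : ∀ i < n, x i < x (i + 1)

/-- The mesh size `h = max_{1 ≤ i ≤ n} (x i - x (i - 1))`. -/
noncomputable def meshSize (n : ℕ) (x : ℕ → ℝ) : ℝ :=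
  ⨆ i : Fin n, (x (i + 1) - x i)

/-- The second derivative, at `t`, of a function on `[a, b]` (one-sided at the end points). -/
noncomputable def secondDeriv (a b : ℝ) (g : ℝ → ℝ) (t : ℝ) : ℝ :=
  iteratedDerivWithin 2 g (Icc a b) t

/-- `s` is a cubic spline on `[a, b]` with knots `x 0, …, x n`: it is twice continuously
differentiable on `[a, b]` and is a polynomial of degree at most three between
consecutive knots. -/
structure IsCubicSpline (a b : ℝ) (n : ℕ) (x : ℕ → ℝ) (s : ℝ → ℝ) : Prop where
  contDiffOn : ContDiffOn ℝ 2 s (Icc a b)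
  cubic : ∀ i < n, ∃ p : Polynomial ℝ, p.natDegree ≤ 3 ∧
    ∀ t ∈ Icc (x i) (x (i + 1)), s t = p.eval t

/-- `s` is the natural cubic spline interpolating `f` at the knots `x 0, …, x n` of `[a, b]`:
its second derivative vanishes at both end points. -/
structure IsNaturalSpline (a b : ℝ) (n : ℕ) (x : ℕ → ℝ) (f s : ℝ → ℝ) : Prop where
  spline : IsCubicSpline a b n x s
  interp : ∀ i ≤ n, s (x i) = f (x i)
  natural_left : secondDeriv a b s a = 0
  natural_right : secondDeriv a b s b = 0

/-- The maximal error `max_{t ∈ [u, v]} |s t - f t|`. -/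
noncomputable def maxError (u v : ℝ) (f s : ℝ → ℝ) : ℝ :=
  ⨆ t : Icc u v, |s t - f t|

/-- The worst-case error `sup ‖s - f‖_∞` of natural spline interpolation of `f` on `[a, b]`, over
all sets of knots with mesh size exactly `h` and at least five knots. -/
noncomputable def worstError (a b : ℝ) (f : ℝ → ℝ) (h : ℝ) : ℝ :=
  sSup {e : ℝ | ∃ (n : ℕ) (x : ℕ → ℝ) (s : ℝ → ℝ), 4 ≤ n ∧ IsMesh a b n x ∧ meshSize n x = h ∧
    IsNaturalSpline a b n x f s ∧ e = maxError a b f s}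

/-!
The mean value theorem bounds the difference of adjacent slopes of `f` by `K = max |f''|` times
the length of the two intervals. These differences are the right-hand sides of the equations
satisfied by the values of `s''` at the knots; the equations being diagonally dominant, a largest
such value is at most `6 * K`, so that `|s''| ≤ 6 * K`. Hence `s - f` vanishes at the knots and its
second derivative is at most `7 * K`, which gives the upper bound. For `f = 0` the same estimate
says `s = 0`: this is uniqueness, and it also shows that the value of `s''(b)` along solutions of
the initial value problem `s''(a) = 0`, `s'(a) = c` really depends on `c`, so shooting succeeds.

For the lower bound, the second difference with weights `2, -5, 4, -1` is exact on cubics, so on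
the first interval it vanishes for `s` because `s''(a) = 0`, while for `f` it is of size
`|f''(a)| (x₁ - x₀) ^ 2 / 9`; the error at the two interior nodes has to make up for this. In
the worst case a mesh whose first and last intervals both have length `h` attains the order `h ^ 2`.
-/

section CubicPolynomial

variable {R : Type*} [CommRing R] {p : Polynomial R}

lemma exists_eval_eq_of_natDegree_le_three (hp : p.natDegree ≤ 3) :
    ∃ c₀ c₁ c₂ c₃ : R, ∀ t : R,
      p.eval t = c₀ + c₁ * t + c₂ * t ^ 2 + c₃ * t ^ 3 ∧
      p.derivative.eval t = c₁ + 2 * c₂ * t + 3 * c₃ * t ^ 2 ∧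
      p.derivative.derivative.eval t = 2 * c₂ + 6 * c₃ * t := by
  obtain ⟨P, rfl⟩ : ∃ P : Cubic R, P.toPoly = p :=
    ⟨Cubic.equiv.symm ⟨p, Polynomial.degree_le_of_natDegree_le hp⟩,
      congrArg Subtype.val (Cubic.equiv.apply_symm_apply _)⟩
  refine ⟨P.d, P.c, P.b, P.a, fun t => ⟨?_, ?_, ?_⟩⟩ <;>
  · simp [Cubic.toPoly]
    ring

lemma six_mul_sub_mul_eval_derivative (hp : p.natDegree ≤ 3) (u v : R) :
    6 * (v - u) * p.derivative.eval v = 6 * (p.eval v - p.eval u) +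
      (v - u) ^ 2 * (p.derivative.derivative.eval u + 2 * p.derivative.derivative.eval v) := by
  obtain ⟨c₀, c₁, c₂, c₃, hc⟩ := exists_eval_eq_of_natDegree_le_three hp
  simp only [hc]
  ring

lemma sub_mul_eval_derivative_derivative (hp : p.natDegree ≤ 3) (u v t : R) :
    (v - u) * p.derivative.derivative.eval t =
      (v - t) * p.derivative.derivative.eval u + (t - u) * p.derivative.derivative.eval v := by
  obtain ⟨c₀, c₁, c₂, c₃, hc⟩ := exists_eval_eq_of_natDegree_le_three hp
  simp only [hc]
  ring

end CubicPolynomial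

section SecondDeriv

variable {a b u v t : ℝ} {f g : ℝ → ℝ}

lemma secondDeriv_eq_derivWithin (a b : ℝ) (f : ℝ → ℝ) :
    secondDeriv a b f = derivWithin (derivWithin f (Icc a b)) (Icc a b) := by
  funext t
  rw [secondDeriv, iteratedDerivWithin_succ, iteratedDerivWithin_one]

lemma secondDeriv_sub (hab : a < b) (hf : ContDiffOn ℝ 2 f (Icc a b))
    (hg : ContDiffOn ℝ 2 g (Icc a b)) (ht : t ∈ Icc a b) :
    secondDeriv a b (f - g) t = secondDeriv a b f t - secondDeriv a b g t :=
  iteratedDerivWithin_sub ht (uniqueDiffOn_Icc hab) (hf t ht) (hg t ht)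

lemma secondDeriv_const_smul (a b c : ℝ) (f : ℝ → ℝ) (t : ℝ) :
    secondDeriv a b (c • f) t = c * secondDeriv a b f t :=
  iteratedDerivWithin_const_mul_field c f

lemma secondDeriv_zero (a b t : ℝ) : secondDeriv a b 0 t = 0 :=
  iteratedDerivWithin_const.trans (if_neg two_ne_zero)

lemma secondDeriv_of_Icc_subset (huv : u < v) (hsub : Icc u v ⊆ Icc a b)
    (hf : ContDiffOn ℝ 2 f (Icc a b)) (ht : t ∈ Icc u v) :
    secondDeriv u v f t = secondDeriv a b f t := by
  have hab : a < b := ((Icc_subset_Icc_iff huv.le).1 hsub).elim fun hau hvb => by linarith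
  simp only [secondDeriv, iteratedDerivWithin]
  rw [iteratedFDerivWithin_subset hsub (uniqueDiffOn_Icc huv) (uniqueDiffOn_Icc hab) hf ht]

lemma derivWithin_eq_of_eqOn_polynomial {s S : Set ℝ} (hs : UniqueDiffWithinAt ℝ s t) (hsub : s ⊆ S)
    (hf : DifferentiableWithinAt ℝ f S t) {p : Polynomial ℝ} (h : EqOn f (p.eval ·) s)
    (ht : t ∈ s) : derivWithin f S t = p.derivative.eval t := by
  rw [← derivWithin_subset hsub hs hf, derivWithin_congr h (h ht), p.derivWithin hs]

lemma differentiableOn_derivWithin_Icc (hab : a < b) (hf : ContDiffOn ℝ 2 f (Icc a b)) :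
    DifferentiableOn ℝ (derivWithin f (Icc a b)) (Icc a b) :=
  (hf.derivWithin (m := 1) (uniqueDiffOn_Icc hab) (by norm_num)).differentiableOn one_ne_zero

lemma secondDeriv_eq_of_eqOn_polynomial (huv : u < v) (hsub : Icc u v ⊆ Icc a b)
    (hf : ContDiffOn ℝ 2 f (Icc a b)) {p : Polynomial ℝ} (h : EqOn f (p.eval ·) (Icc u v))
    (ht : t ∈ Icc u v) : secondDeriv a b f t = p.derivative.derivative.eval t := by
  have hab : a < b := ((Icc_subset_Icc_iff huv.le).1 hsub).elim fun hau hvb => by linarith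
  have huniq := uniqueDiffOn_Icc huv
  rw [secondDeriv_eq_derivWithin]
  exact derivWithin_eq_of_eqOn_polynomial (huniq t ht) hsub
    (differentiableOn_derivWithin_Icc hab hf t (hsub ht))
    (fun y hy => derivWithin_eq_of_eqOn_polynomial (huniq y hy) hsub
      (hf.differentiableOn two_ne_zero y (hsub hy)) h hy) ht

lemma exists_forall_abs_secondDeriv_le (hab : a < b) (hf : ContDiffOn ℝ 2 f (Icc a b)) :
    ∃ K > 0, ∀ t ∈ Icc a b, |secondDeriv a b f t| ≤ K := by
  obtain ⟨K, hK⟩ := isCompact_Icc.exists_bound_of_continuousOn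
    (hf.continuousOn_iteratedDerivWithin le_rfl (uniqueDiffOn_Icc hab))
  exact ⟨max K 1, by positivity, fun t ht => (hK t ht).trans (le_max_left _ _)⟩

lemma exists_derivWithin_eq_slope (huv : u < v) (hsub : Icc u v ⊆ Icc a b)
    (hf : DifferentiableOn ℝ f (Icc a b)) :
    ∃ ξ ∈ Ioo u v, derivWithin f (Icc a b) ξ = slope f u v := by
  rw [slope_def_field]
  refine exists_hasDerivAt_eq_slope f _ huv (hf.continuousOn.mono hsub) fun ξ hξ => ?_
  exact (hf ξ (hsub (Ioo_subset_Icc_self hξ))).hasDerivWithinAt.hasDerivAt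
    (mem_of_superset (Icc_mem_nhds hξ.1 hξ.2) hsub)

lemma abs_slope_sub_slope_le {K : ℝ} (hf : ContDiffOn ℝ 2 f (Icc a b))
    (hK : ∀ y ∈ Icc a b, |secondDeriv a b f y| ≤ K) (hu : u ∈ Icc a b) (hv : v ∈ Icc a b)
    (hut : u < t) (htv : t < v) : |slope f t v - slope f u t| ≤ K * (v - u) := by
  have hab : a < b := by linarith [hu.1, hv.2]
  have hd := hf.differentiableOn two_ne_zero
  obtain ⟨ξ, hξ, hξ_eq⟩ := exists_derivWithin_eq_slope hut
    (Icc_subset_Icc hu.1 (htv.le.trans hv.2)) hd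
  obtain ⟨η, hη, hη_eq⟩ := exists_derivWithin_eq_slope htv
    (Icc_subset_Icc (hu.1.trans hut.le) hv.2) hd
  have hξ_mem : ξ ∈ Icc a b := ⟨hu.1.trans hξ.1.le, by linarith [hξ.2, hv.2]⟩
  have hη_mem : η ∈ Icc a b := ⟨by linarith [hη.1, hu.1], hη.2.le.trans hv.2⟩
  have hK0 : 0 ≤ K := (abs_nonneg _).trans (hK u hu)
  rw [← hξ_eq, ← hη_eq]
  calc |derivWithin f (Icc a b) η - derivWithin f (Icc a b) ξ| ≤ K * |η - ξ| :=
        (convex_Icc a b).norm_image_sub_le_of_norm_derivWithin_le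
          (differentiableOn_derivWithin_Icc hab hf)
          (fun y hy => by simpa [← secondDeriv_eq_derivWithin] using hK y hy) hξ_mem hη_mem
    _ ≤ K * (v - u) := by
        rw [abs_of_pos (by linarith [hξ.2, hη.1])]
        gcongr
        exacts [hη.2.le, hξ.1.le]

lemma abs_le_mul_of_abs_secondDeriv_le {K : ℝ} (hf : ContDiffOn ℝ 2 f (Icc a b))
    (hK : ∀ y ∈ Icc a b, |secondDeriv a b f y| ≤ K) (hu : u ∈ Icc a b) (hv : v ∈ Icc a b)
    (hfu : f u = 0) (hfv : f v = 0) (ht : t ∈ Icc u v) : |f t| ≤ K * ((t - u) * (v - t)) := by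
  rcases ht.1.eq_or_lt with rfl | hut
  · simp [hfu]
  rcases ht.2.eq_or_lt with rfl | htv
  · simp [hfv]
  have h := abs_slope_sub_slope_le hf hK hu hv hut htv
  have hslope : slope f t v - slope f u t = -(v - u) * f t / ((t - u) * (v - t)) := by
    rw [slope_def_field, slope_def_field, hfu, hfv]
    field_simp [(sub_pos.2 hut).ne', (sub_pos.2 htv).ne']
    ring
  have hpos : 0 < (t - u) * (v - t) := mul_pos (sub_pos.2 hut) (sub_pos.2 htv)
  rw [hslope, abs_div, abs_of_pos hpos, abs_mul, abs_neg, abs_of_pos (by linarith : 0 < v - u),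
    div_le_iff₀ hpos] at h
  exact le_of_mul_le_mul_left (by linarith) (by linarith : 0 < v - u)

end SecondDeriv

section MaxError

variable {u v : ℝ} {f s : ℝ → ℝ}

lemma maxError_nonneg (u v : ℝ) (f s : ℝ → ℝ) : 0 ≤ maxError u v f s :=
  Real.iSup_nonneg fun _ => abs_nonneg _

lemma maxError_le {C : ℝ} (hC : 0 ≤ C) (h : ∀ t ∈ Icc u v, |s t - f t| ≤ C) :
    maxError u v f s ≤ C :=
  Real.iSup_le (fun t => h t t.2) hC

lemma abs_sub_le_maxError (hs : ContinuousOn s (Icc u v)) (hf : ContinuousOn f (Icc u v)) {t : ℝ}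
    (ht : t ∈ Icc u v) : |s t - f t| ≤ maxError u v f s := by
  obtain ⟨C, hC⟩ := isCompact_Icc.exists_bound_of_continuousOn (hs.sub hf)
  exact le_ciSup (f := fun t : Icc u v => |s t - f t|) ⟨C, forall_mem_range.2 fun y => hC y y.2⟩
    ⟨t, ht⟩

lemma maxError_mono {u' v' : ℝ} (hs : ContinuousOn s (Icc u v)) (hf : ContinuousOn f (Icc u v))
    (hsub : Icc u' v' ⊆ Icc u v) : maxError u' v' f s ≤ maxError u v f s :=
  maxError_le (maxError_nonneg u v f s) fun _ ht => abs_sub_le_maxError hs hf (hsub ht)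

end MaxError

section Mesh

variable {n : ℕ} {x : ℕ → ℝ}

lemma sub_le_meshSize (x : ℕ → ℝ) {i : ℕ} (hi : i < n) : x (i + 1) - x i ≤ meshSize n x :=
  le_ciSup (f := fun i : Fin n => x (i + 1) - x i) (finite_range _).bddAbove ⟨i, hi⟩

lemma meshSize_le {h : ℝ} (hh : 0 ≤ h) (hle : ∀ i < n, x (i + 1) - x i ≤ h) : meshSize n x ≤ h :=
  Real.iSup_le (fun i => hle i i.2) hh

end Mesh

namespace IsMesh

variable {a b : ℝ} {n : ℕ} {x : ℕ → ℝ}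

lemma pos (hx : IsMesh a b n x) (hab : a < b) : 0 < n :=
  Nat.pos_of_ne_zero fun hn => hab.ne (by rw [← hx.left, ← hx.right, hn])

lemma strictMonoOn (hx : IsMesh a b n x) : StrictMonoOn x (Iic n) :=
  strictMonoOn_of_lt_add_one ordConnected_Iic fun i _ _ hi => hx.lt i hi

lemma mem_Icc (hx : IsMesh a b n x) {i : ℕ} (hi : i ≤ n) : x i ∈ Icc a b := by
  rw [← hx.left, ← hx.right]
  exact ⟨hx.strictMonoOn.monotoneOn (mem_Iic.2 (Nat.zero_le n)) hi (Nat.zero_le i),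
    hx.strictMonoOn.monotoneOn hi self_mem_Iic hi⟩

lemma Icc_subset (hx : IsMesh a b n x) {i : ℕ} (hi : i < n) : Icc (x i) (x (i + 1)) ⊆ Icc a b :=
  Icc_subset_Icc (hx.mem_Icc hi.le).1 (hx.mem_Icc hi).2

lemma exists_mem_Icc (hx : IsMesh a b n x) (hn : 0 < n) {t : ℝ} (ht : t ∈ Icc a b) :
    ∃ i < n, t ∈ Icc (x i) (x (i + 1)) := by
  induction n, hn using Nat.le_induction generalizing b with
  | base => exact ⟨0, one_pos, hx.left ▸ ht.1, hx.right ▸ ht.2⟩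
  | succ n _ ih =>
    rcases le_total t (x n) with htn | htn
    · obtain ⟨i, hi, hti⟩ := ih ⟨hx.left, rfl, fun i hi => hx.lt i (by omega)⟩ ⟨ht.1, htn⟩
      exact ⟨i, by omega, hti⟩
    · exact ⟨n, by omega, htn, hx.right ▸ ht.2⟩

end IsMesh

namespace IsCubicSpline

variable {a b : ℝ} {n : ℕ} {x : ℕ → ℝ} {s r : ℝ → ℝ}

lemma sub (hs : IsCubicSpline a b n x s) (hr : IsCubicSpline a b n x r) :
    IsCubicSpline a b n x (s - r) where
  contDiffOn := hs.contDiffOn.sub hr.contDiffOn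
  cubic i hi := by
    obtain ⟨p, hp, hsp⟩ := hs.cubic i hi
    obtain ⟨q, hq, hrq⟩ := hr.cubic i hi
    exact ⟨p - q, (p.natDegree_sub_le q).trans (max_le hp hq), fun t ht => by
      rw [Pi.sub_apply, hsp t ht, hrq t ht, Polynomial.eval_sub]⟩

lemma const_smul (hs : IsCubicSpline a b n x s) (c : ℝ) : IsCubicSpline a b n x (c • s) where
  contDiffOn := hs.contDiffOn.const_smul c
  cubic i hi := by
    obtain ⟨p, hp, hsp⟩ := hs.cubic i hi
    exact ⟨c • p, (Polynomial.natDegree_smul_le c p).trans hp, fun t ht => by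
      rw [Pi.smul_apply, hsp t ht, Polynomial.eval_smul]⟩

lemma derivWithin_eq_slope_add (hs : IsCubicSpline a b n x s) (hx : IsMesh a b n x) {i : ℕ}
    (hi : i < n) {u v : ℝ} (hu : u ∈ Icc (x i) (x (i + 1))) (hv : v ∈ Icc (x i) (x (i + 1)))
    (huv : u ≠ v) :
    derivWithin s (Icc a b) v =
      slope s u v + (v - u) / 6 * (secondDeriv a b s u + 2 * secondDeriv a b s v) := by
  obtain ⟨p, hp, hsp⟩ := hs.cubic i hi
  have hlt := hx.lt i hi
  have hsub := hx.Icc_subset hi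
  have hsecond {t : ℝ} (ht : t ∈ Icc (x i) (x (i + 1))) :=
    secondDeriv_eq_of_eqOn_polynomial hlt hsub hs.contDiffOn hsp ht
  rw [derivWithin_eq_of_eqOn_polynomial (uniqueDiffOn_Icc hlt v hv) hsub
    (hs.contDiffOn.differentiableOn two_ne_zero v (hsub hv)) hsp hv, hsecond hu, hsecond hv,
    slope_def_field, hsp u hu, hsp v hv]
  have hne : v - u ≠ 0 := sub_ne_zero.2 huv.symm
  field_simp
  linear_combination six_mul_sub_mul_eval_derivative hp u v

lemma moment_eq (hs : IsCubicSpline a b n x s) (hx : IsMesh a b n x) {i : ℕ} (hi : i + 1 < n) :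
    (x (i + 1) - x i) * secondDeriv a b s (x i) +
        2 * (x (i + 2) - x i) * secondDeriv a b s (x (i + 1)) +
        (x (i + 2) - x (i + 1)) * secondDeriv a b s (x (i + 2)) =
      6 * (slope s (x (i + 1)) (x (i + 2)) - slope s (x i) (x (i + 1))) := by
  have hlt := hx.lt i (by omega)
  have hlt' := hx.lt (i + 1) hi
  have hleft := hs.derivWithin_eq_slope_add hx (by omega) (left_mem_Icc.2 hlt.le)
    (right_mem_Icc.2 hlt.le) hlt.ne
  have hright := hs.derivWithin_eq_slope_add hx hi (right_mem_Icc.2 hlt'.le)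
    (left_mem_Icc.2 hlt'.le) hlt'.ne'
  rw [slope_comm] at hright
  linear_combination 6 * hright - 6 * hleft

lemma abs_secondDeriv_le_of_knots (hs : IsCubicSpline a b n x s) (hx : IsMesh a b n x)
    (hn : 0 < n) {B : ℝ} (hB : ∀ i ≤ n, |secondDeriv a b s (x i)| ≤ B) {t : ℝ}
    (ht : t ∈ Icc a b) : |secondDeriv a b s t| ≤ B := by
  obtain ⟨i, hi, hti⟩ := hx.exists_mem_Icc hn ht
  obtain ⟨p, hp, hsp⟩ := hs.cubic i hi
  have hlt := hx.lt i hi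
  have hsecond {y : ℝ} (hy : y ∈ Icc (x i) (x (i + 1))) :=
    secondDeriv_eq_of_eqOn_polynomial hlt (hx.Icc_subset hi) hs.contDiffOn hsp hy
  have haffine := sub_mul_eval_derivative_derivative hp (x i) (x (i + 1)) t
  rw [← hsecond hti, ← hsecond (left_mem_Icc.2 hlt.le), ← hsecond (right_mem_Icc.2 hlt.le)]
    at haffine
  have hleft := hB i hi.le
  have hright := hB (i + 1) hi
  refine le_of_mul_le_mul_left ?_ (sub_pos.2 hlt)
  calc (x (i + 1) - x i) * |secondDeriv a b s t|
      = |(x (i + 1) - t) * secondDeriv a b s (x i) +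
          (t - x i) * secondDeriv a b s (x (i + 1))| := by
        rw [← haffine, abs_mul, abs_of_pos (sub_pos.2 hlt)]
    _ ≤ (x (i + 1) - t) * |secondDeriv a b s (x i)| +
          (t - x i) * |secondDeriv a b s (x (i + 1))| := by
        refine (abs_add_le _ _).trans_eq ?_
        rw [abs_mul, abs_mul, abs_of_nonneg (sub_nonneg.2 hti.2),
          abs_of_nonneg (sub_nonneg.2 hti.1)]
    _ ≤ (x (i + 1) - t) * B + (t - x i) * B := by
        gcongr
        exacts [sub_nonneg.2 hti.2, sub_nonneg.2 hti.1]
    _ = (x (i + 1) - x i) * B := by ring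

end IsCubicSpline

lemma abs_le_of_abs_diagDominant_le {h h' m₀ m₁ m₂ B : ℝ} (hh : 0 < h) (hh' : 0 < h')
    (h₀ : |m₀| ≤ |m₁|) (h₂ : |m₂| ≤ |m₁|)
    (hB : |h * m₀ + 2 * (h + h') * m₁ + h' * m₂| ≤ B * (h + h')) : |m₁| ≤ B := by
  have htri : 2 * (h + h') * |m₁| ≤ B * (h + h') + h * |m₀| + h' * |m₂| :=
    calc 2 * (h + h') * |m₁|
        = |(h * m₀ + 2 * (h + h') * m₁ + h' * m₂) - h * m₀ - h' * m₂| := by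
          rw [show h * m₀ + 2 * (h + h') * m₁ + h' * m₂ - h * m₀ - h' * m₂ =
            2 * (h + h') * m₁ by ring, abs_mul, abs_of_pos (by positivity : 0 < 2 * (h + h'))]
      _ ≤ |h * m₀ + 2 * (h + h') * m₁ + h' * m₂| + |h * m₀| + |h' * m₂| :=
          (abs_sub _ _).trans (by gcongr; exact abs_sub _ _)
      _ ≤ B * (h + h') + h * |m₀| + h' * |m₂| := by
          rw [abs_mul h, abs_mul h', abs_of_pos hh, abs_of_pos hh']
          gcongr
  refine le_of_mul_le_mul_left ?_ (add_pos hh hh')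
  linarith [mul_le_mul_of_nonneg_left h₀ hh.le, mul_le_mul_of_nonneg_left h₂ hh'.le]

namespace IsNaturalSpline

variable {a b K : ℝ} {n : ℕ} {x : ℕ → ℝ} {f s r : ℝ → ℝ}

lemma abs_secondDeriv_knot_le (hs : IsNaturalSpline a b n x f s) (hx : IsMesh a b n x)
    (hf : ContDiffOn ℝ 2 f (Icc a b)) (hK : ∀ t ∈ Icc a b, |secondDeriv a b f t| ≤ K) {i : ℕ}
    (hi : i ≤ n) : |secondDeriv a b s (x i)| ≤ 6 * K := by
  have hK0 : 0 ≤ K := (abs_nonneg _).trans (hK _ (hx.mem_Icc hi))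
  obtain ⟨j, hj, hmax⟩ := (Iic n).exists_max_image (fun j => |secondDeriv a b s (x j)|)
    (finite_Iic n) nonempty_Iic
  refine (hmax i hi).trans ?_
  rcases Nat.eq_zero_or_pos j with rfl | hj0
  · rw [hx.left, hs.natural_left, abs_zero]
    positivity
  rcases (mem_Iic.1 hj).eq_or_lt with rfl | hjn
  · rw [hx.right, hs.natural_right, abs_zero]
    positivity
  obtain ⟨m, rfl⟩ := Nat.exists_eq_add_one.2 hj0
  have hlt := hx.lt m (by omega)
  have hlt' := hx.lt (m + 1) hjn
  refine abs_le_of_abs_diagDominant_le (sub_pos.2 hlt) (sub_pos.2 hlt')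
    (hmax m (mem_Iic.2 (by omega))) (hmax (m + 2) hjn) ?_
  have hslope := abs_slope_sub_slope_le hf hK (hx.mem_Icc (by omega : m ≤ n)) (hx.mem_Icc hjn)
    hlt hlt'
  have hmoment := hs.spline.moment_eq hx hjn
  simp only [slope_def_field, hs.interp m (by omega), hs.interp (m + 1) hj,
    hs.interp (m + 2) hjn] at hmoment hslope
  rw [sub_add_sub_cancel', hmoment, abs_mul, abs_of_pos (by norm_num : (0 : ℝ) < 6)]
  linarith

lemma abs_secondDeriv_le (hs : IsNaturalSpline a b n x f s) (hab : a < b) (hx : IsMesh a b n x)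
    (hf : ContDiffOn ℝ 2 f (Icc a b)) (hK : ∀ t ∈ Icc a b, |secondDeriv a b f t| ≤ K) {t : ℝ}
    (ht : t ∈ Icc a b) : |secondDeriv a b s t| ≤ 6 * K :=
  hs.spline.abs_secondDeriv_le_of_knots hx (hx.pos hab)
    (fun _ hi => hs.abs_secondDeriv_knot_le hx hf hK hi) ht

lemma abs_sub_le (hs : IsNaturalSpline a b n x f s) (hab : a < b) (hx : IsMesh a b n x)
    (hf : ContDiffOn ℝ 2 f (Icc a b)) (hK : ∀ t ∈ Icc a b, |secondDeriv a b f t| ≤ K) {t : ℝ}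
    (ht : t ∈ Icc a b) : |s t - f t| ≤ 7 / 4 * K * meshSize n x ^ 2 := by
  obtain ⟨i, hi, hti⟩ := hx.exists_mem_Icc (hx.pos hab) ht
  have hK0 : 0 ≤ K := (abs_nonneg _).trans (hK t ht)
  have herr : ∀ y ∈ Icc a b, |secondDeriv a b (s - f) y| ≤ 7 * K := fun y hy => by
    rw [secondDeriv_sub hab hs.spline.contDiffOn hf hy]
    linarith [abs_sub (secondDeriv a b s y) (secondDeriv a b f y),
      hs.abs_secondDeriv_le hab hx hf hK hy, hK y hy]
  have hlocal := abs_le_mul_of_abs_secondDeriv_le (hs.spline.contDiffOn.sub hf) herr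
    (hx.mem_Icc hi.le) (hx.mem_Icc hi) (sub_eq_zero.2 (hs.interp i hi.le))
    (sub_eq_zero.2 (hs.interp (i + 1) hi)) hti
  have hprod : (t - x i) * (x (i + 1) - t) ≤ meshSize n x ^ 2 / 4 := by
    have hgap := pow_le_pow_left₀ (sub_nonneg.2 (hti.1.trans hti.2)) (sub_le_meshSize x hi) 2
    linarith [four_mul_le_sq_add (t - x i) (x (i + 1) - t)]
  calc |s t - f t| ≤ 7 * K * ((t - x i) * (x (i + 1) - t)) := hlocal
    _ ≤ 7 * K * (meshSize n x ^ 2 / 4) := by gcongr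
    _ = 7 / 4 * K * meshSize n x ^ 2 := by ring

lemma sub {g : ℝ → ℝ} (hs : IsNaturalSpline a b n x f s) (hr : IsNaturalSpline a b n x g r)
    (hab : a < b) : IsNaturalSpline a b n x (f - g) (s - r) where
  spline := hs.spline.sub hr.spline
  interp i hi := by rw [Pi.sub_apply, Pi.sub_apply, hs.interp i hi, hr.interp i hi]
  natural_left := by
    rw [secondDeriv_sub hab hs.spline.contDiffOn hr.spline.contDiffOn (left_mem_Icc.2 hab.le),
      hs.natural_left, hr.natural_left, sub_zero]
  natural_right := by
    rw [secondDeriv_sub hab hs.spline.contDiffOn hr.spline.contDiffOn (right_mem_Icc.2 hab.le),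
      hs.natural_right, hr.natural_right, sub_zero]

lemma eqOn_zero (hs : IsNaturalSpline a b n x 0 s) (hab : a < b) (hx : IsMesh a b n x) :
    EqOn s 0 (Icc a b) := fun t ht => by
  simpa using hs.abs_sub_le hab hx contDiffOn_const
    (fun y _ => (abs_eq_zero.2 (secondDeriv_zero a b y)).le) ht

lemma eqOn (hs : IsNaturalSpline a b n x f s) (hr : IsNaturalSpline a b n x f r) (hab : a < b)
    (hx : IsMesh a b n x) : EqOn s r (Icc a b) := fun _ ht =>
  sub_eq_zero.1 ((sub_self f ▸ hs.sub hr hab).eqOn_zero hab hx ht)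

end IsNaturalSpline

section TruncatedPower

lemma hasDerivAt_max_zero_pow (k : ℕ) (t : ℝ) :
    HasDerivAt (fun t : ℝ => max t 0 ^ (k + 2)) ((k + 2) * max t 0 ^ (k + 1)) t := by
  have hne : ∀ y : ℝ, y ≠ 0 →
      HasDerivAt (fun t : ℝ => max t 0 ^ (k + 2)) ((k + 2) * max y 0 ^ (k + 1)) y := fun y hy => by
    rcases hy.lt_or_gt with hy | hy
    · rw [max_eq_right hy.le, zero_pow k.succ_ne_zero, mul_zero]
      refine (hasDerivAt_const y (0 : ℝ)).congr_of_eventuallyEq ?_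
      filter_upwards [Iio_mem_nhds hy] with z hz
      rw [max_eq_right (mem_Iio.1 hz).le, zero_pow (k + 1).succ_ne_zero]
    · rw [max_eq_left hy.le]
      refine ((hasDerivAt_pow (k + 2) y).congr_deriv (by norm_num)).congr_of_eventuallyEq ?_
      filter_upwards [Ioi_mem_nhds hy] with z hz
      rw [max_eq_left (mem_Ioi.1 hz).le]
  rcases eq_or_ne t 0 with rfl | ht
  · exact hasDerivAt_of_hasDerivAt_of_ne hne (by fun_prop) (by fun_prop)
  · exact hne t ht

lemma contDiff_max_zero_pow (k : ℕ) : ContDiff ℝ k (fun t : ℝ => max t 0 ^ (k + 1)) := by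
  induction k with
  | zero => exact contDiff_zero.2 (by fun_prop)
  | succ k ih =>
    have hderiv := hasDerivAt_max_zero_pow k
    rw [Nat.cast_succ, contDiff_succ_iff_deriv]
    refine ⟨fun t => (hderiv t).differentiableAt, by simp, ?_⟩
    rw [show deriv (fun t : ℝ => max t 0 ^ (k + 1 + 1)) = _ from funext fun t => (hderiv t).deriv]
    exact contDiff_const.mul ih

end TruncatedPower

/-- A shooting spline: the `C²` piecewise cubic interpolant of `f` at the knots `x 0, …, x n` that
leaves `x 0` with prescribed slope `c` and vanishing second derivative, extended to the whole line
by an affine function on the left and by a single cubic on the right. It is the solution of the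
initial value problem from which natural splines are obtained by adjusting `c`. -/
structure IsShootingSpline (n : ℕ) (x : ℕ → ℝ) (f : ℝ → ℝ) (c : ℝ) (s : ℝ → ℝ) : Prop where
  contDiff : ContDiff ℝ 2 s
  affine : ∀ t ≤ x 0, s t = f (x 0) + c * (t - x 0)
  cubic : ∀ i < n, ∃ p : Polynomial ℝ, p.natDegree ≤ 3 ∧
    ∀ t ∈ Icc (x i) (x (i + 1)), s t = p.eval t
  cubic_right : ∃ p : Polynomial ℝ, p.natDegree ≤ 3 ∧ ∀ t, x n ≤ t → s t = p.eval t
  interp : ∀ i ≤ n, s (x i) = f (x i)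

namespace IsShootingSpline

variable {a b c : ℝ} {n : ℕ} {x : ℕ → ℝ} {f s : ℝ → ℝ}

lemma zero (x : ℕ → ℝ) (f : ℝ → ℝ) (c : ℝ) :
    IsShootingSpline 0 x f c fun t => f (x 0) + c * (t - x 0) where
  contDiff := by fun_prop
  affine _ _ := rfl
  cubic _ hi := absurd hi (Nat.not_lt_zero _)
  cubic_right := by
    refine ⟨Polynomial.C (f (x 0)) + Polynomial.C c * (Polynomial.X - Polynomial.C (x 0)), ?_,
      by simp⟩
    compute_degree!
  interp i hi := by
    obtain rfl := Nat.le_zero.1 hi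
    ring

lemma exists_succ (hs : IsShootingSpline n x f c s) (hx : StrictMonoOn x (Iic (n + 1))) :
    ∃ r, IsShootingSpline (n + 1) x f c r := by
  obtain ⟨p, hp, hsp⟩ := hs.cubic_right
  have hle {i : ℕ} (hi : i ≤ n) : x i ≤ x n :=
    hx.monotoneOn (mem_Iic.2 (by omega)) (mem_Iic.2 n.le_succ) hi
  have hlt : x n < x (n + 1) := hx (mem_Iic.2 n.le_succ) self_mem_Iic n.lt_succ_self
  set d := (f (x (n + 1)) - s (x (n + 1))) / (x (n + 1) - x n) ^ 3 with hd
  set r := fun t => s t + d * max (t - x n) 0 ^ 3 with hr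
  set q := p + Polynomial.C d * (Polynomial.X - Polynomial.C (x n)) ^ 3 with hq
  have hrs {t : ℝ} (ht : t ≤ x n) : r t = s t := by simp [hr, max_eq_right (sub_nonpos.2 ht)]
  have hrq {t : ℝ} (ht : x n ≤ t) : r t = q.eval t := by
    simp [hr, hq, max_eq_left (sub_nonneg.2 ht), hsp t ht]
  have hqdeg : q.natDegree ≤ 3 := by
    have : (Polynomial.C d * (Polynomial.X - Polynomial.C (x n)) ^ 3).natDegree ≤ 3 := by
      compute_degree!
    exact Polynomial.natDegree_add_le_of_degree_le hp this
  refine ⟨r, ?_, fun t ht => ?_, fun i hi => ?_, ⟨q, hqdeg, fun t ht => hrq (hlt.le.trans ht)⟩,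
    fun i hi => ?_⟩
  · exact hs.contDiff.add (contDiff_const.mul
      ((contDiff_max_zero_pow 2).comp (contDiff_id.sub contDiff_const)))
  · rw [hrs (ht.trans (hle n.zero_le)), hs.affine t ht]
  · rcases Nat.lt_succ_iff_lt_or_eq.1 hi with hi | rfl
    · obtain ⟨p', hp', hsp'⟩ := hs.cubic i hi
      exact ⟨p', hp', fun t ht => (hrs (ht.2.trans (hle hi))).trans (hsp' t ht)⟩
    · exact ⟨q, hqdeg, fun t ht => hrq ht.1⟩
  · rcases Nat.le_succ_iff.1 hi with hi | rfl
    · rw [hrs (hle hi), hs.interp i hi]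
    · have hpos : 0 < x (n + 1) - x n := sub_pos.2 hlt
      simp only [hr, max_eq_left hpos.le, hd, div_mul_cancel₀ _ (pow_pos hpos 3).ne',
        add_sub_cancel]

lemma exists_of_strictMonoOn (hx : StrictMonoOn x (Iic n)) (f : ℝ → ℝ) (c : ℝ) :
    ∃ s, IsShootingSpline n x f c s := by
  induction n with
  | zero => exact ⟨_, zero x f c⟩
  | succ n ih =>
    obtain ⟨s, hs⟩ := ih (hx.mono (Iic_subset_Iic.2 n.le_succ))
    exact hs.exists_succ hx

lemma isCubicSpline (hs : IsShootingSpline n x f c s) (a b : ℝ) : IsCubicSpline a b n x s :=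
  ⟨hs.contDiff.contDiffOn, hs.cubic⟩

lemma eqOn_affine (hs : IsShootingSpline n x f c s) (u : ℝ) : EqOn s
    ((Polynomial.C (f (x 0)) + Polynomial.C c * (Polynomial.X - Polynomial.C (x 0))).eval ·)
    (Icc u (x 0)) := fun t ht => by
  simp [hs.affine t ht.2]

lemma deriv_left (hs : IsShootingSpline n x f c s) : deriv s (x 0) = c := by
  have hu := sub_one_lt (x 0)
  have := derivWithin_eq_of_eqOn_polynomial (uniqueDiffOn_Icc hu _ (right_mem_Icc.2 hu.le))
    (subset_univ _) ((hs.contDiff.differentiable two_ne_zero _).differentiableWithinAt)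
    (hs.eqOn_affine _) (right_mem_Icc.2 hu.le)
  simpa using this

lemma secondDeriv_left (hs : IsShootingSpline n x f c s) (hb : x 0 < b) :
    secondDeriv (x 0) b s (x 0) = 0 := by
  have hu := sub_one_lt (x 0)
  rw [secondDeriv_of_Icc_subset hb (Icc_subset_Icc_left hu.le) hs.contDiff.contDiffOn
      (left_mem_Icc.2 hb.le), secondDeriv_eq_of_eqOn_polynomial hu (Icc_subset_Icc_right hb.le)
      hs.contDiff.contDiffOn (hs.eqOn_affine _) (right_mem_Icc.2 hu.le)]
  simp

lemma secondDeriv_right_ne_zero (hs : IsShootingSpline n x 0 c s) (hab : a < b)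
    (hx : IsMesh a b n x) (hc : c ≠ 0) : secondDeriv a b s b ≠ 0 := fun hright => by
  obtain rfl := hx.left
  have hnat : IsNaturalSpline (x 0) b n x 0 s :=
    ⟨hs.isCubicSpline _ b, hs.interp, hs.secondDeriv_left hab, hright⟩
  have hzero := hnat.eqOn_zero hab hx
  have ha := left_mem_Icc.2 hab.le
  refine hc ?_
  rw [← hs.deriv_left, ← (hs.contDiff.differentiable two_ne_zero _).derivWithin
    (uniqueDiffOn_Icc hab _ ha), derivWithin_congr hzero (hzero ha),
    derivWithin_zero, Pi.zero_apply]

end IsShootingSpline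

theorem exists_isNaturalSpline {a b : ℝ} {n : ℕ} {x : ℕ → ℝ} (hab : a < b) (hx : IsMesh a b n x)
    (f : ℝ → ℝ) : ∃ s, IsNaturalSpline a b n x f s := by
  obtain rfl := hx.left
  obtain ⟨g, hg⟩ := IsShootingSpline.exists_of_strictMonoOn hx.strictMonoOn f 0
  obtain ⟨z, hz⟩ := IsShootingSpline.exists_of_strictMonoOn hx.strictMonoOn 0 1
  have hzb := hz.secondDeriv_right_ne_zero hab hx one_ne_zero
  set q := secondDeriv (x 0) b g b / secondDeriv (x 0) b z b
  have hgs := hg.isCubicSpline (x 0) b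
  have hzs := (hz.isCubicSpline (x 0) b).const_smul q
  have hsecond {t : ℝ} (ht : t ∈ Icc (x 0) b) : secondDeriv (x 0) b (g - q • z) t =
      secondDeriv (x 0) b g t - q * secondDeriv (x 0) b z t := by
    rw [secondDeriv_sub hab hgs.contDiffOn hzs.contDiffOn ht, secondDeriv_const_smul]
  refine ⟨g - q • z, hgs.sub hzs, fun i hi => by simp [hg.interp i hi, hz.interp i hi], ?_, ?_⟩
  · rw [hsecond (left_mem_Icc.2 hab.le), hg.secondDeriv_left hab, hz.secondDeriv_left hab,
      mul_zero, sub_zero]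
  · rw [hsecond (right_mem_Icc.2 hab.le), div_mul_cancel₀ _ hzb, sub_self]

section OneSidedSecondDiff

open AffineMap

variable {a b p q : ℝ} {f s : ℝ → ℝ}

/-- The one-sided second difference of `g` at `p` on the four equidistant nodes from `p` to `q`.
The weights `2, -5, 4, -1` make it exact, up to the factor `((q - p) / 3) ^ 2`, for the second
derivative at `p` of cubic polynomials. -/
noncomputable def oneSidedSecondDiff (g : ℝ → ℝ) (p q : ℝ) : ℝ :=
  2 * g p - 5 * g (lineMap p q (1 / 3 : ℝ)) + 4 * g (lineMap p q (2 / 3 : ℝ)) - g q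

lemma oneSidedSecondDiff_eval {P : Polynomial ℝ} (hP : P.natDegree ≤ 3) (p q : ℝ) :
    oneSidedSecondDiff (P.eval ·) p q =
      ((q - p) / 3) ^ 2 * P.derivative.derivative.eval p := by
  obtain ⟨c₀, c₁, c₂, c₃, hc⟩ := exists_eval_eq_of_natDegree_le_three hP
  simp only [oneSidedSecondDiff, hc, lineMap_apply_ring']
  ring

lemma isLittleO_comp_lineMap {R : ℝ → ℝ} (hR : R =o[𝓝[Icc a b] p] fun t => (t - p) ^ 2)
    (hp : p ∈ Icc a b) {θ : ℝ} (hθ : θ ∈ Icc (0 : ℝ) 1) :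
    (fun q => R (lineMap p q θ)) =o[𝓝[Icc a b] p] fun q => (q - p) ^ 2 := by
  have htendsto : Tendsto (fun q => lineMap p q θ) (𝓝[Icc a b] p) (𝓝[Icc a b] p) := by
    refine tendsto_nhdsWithin_of_tendsto_nhds_of_eventually_within _ ?_ ?_
    · have hcont : Continuous fun q : ℝ => lineMap p q θ := by
        simp only [lineMap_apply_ring']
        fun_prop
      exact (hcont.tendsto' p p (lineMap_same_apply p θ)).mono_left nhdsWithin_le_nhds
    · filter_upwards [self_mem_nhdsWithin] with q hq using (convex_Icc a b).lineMap_mem hp hq hθ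
  refine (hR.comp_tendsto htendsto).trans_isBigO ?_
  refine ((isBigO_refl (fun q => (q - p) ^ 2) _).const_mul_left (θ ^ 2)).congr_left fun q => ?_
  rw [Function.comp_apply, lineMap_apply_ring']
  ring

lemma isLittleO_oneSidedSecondDiff_sub (hf : ContDiffOn ℝ 2 f (Icc a b)) (hp : p ∈ Icc a b) :
    (fun q => oneSidedSecondDiff f p q - ((q - p) / 3) ^ 2 * secondDeriv a b f p)
      =o[𝓝[Icc a b] p] fun q => (q - p) ^ 2 := by
  have htaylor := taylor_isLittleO (n := 2) (convex_Icc a b) hp hf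
  have hthird := isLittleO_comp_lineMap htaylor hp (θ := 1 / 3) (by norm_num)
  have htwoThirds := isLittleO_comp_lineMap htaylor hp (θ := 2 / 3) (by norm_num)
  refine (((htwoThirds.const_mul_left 4).sub (hthird.const_mul_left 5)).sub htaylor).congr_left
    fun q => ?_
  simp only [oneSidedSecondDiff, taylorWithinEval_succ, taylor_within_zero_eval, secondDeriv,
    lineMap_apply_ring', Nat.factorial, smul_eq_mul]
  push_cast
  ring

lemma exists_mul_sq_le_abs_oneSidedSecondDiff (hf : ContDiffOn ℝ 2 f (Icc a b))
    (hp : p ∈ Icc a b) : ∃ δ > 0, ∀ q ∈ Icc a b, |q - p| < δ →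
      |secondDeriv a b f p| / 18 * (q - p) ^ 2 ≤ |oneSidedSecondDiff f p q| := by
  rcases eq_or_ne (secondDeriv a b f p) 0 with hzero | hne
  · exact ⟨1, one_pos, fun q _ _ => by simp [hzero]⟩
  obtain ⟨δ, hδ, hball⟩ := Metric.mem_nhdsWithin_iff.1
    ((isLittleO_oneSidedSecondDiff_sub hf hp).def (by positivity : 0 < |secondDeriv a b f p| / 18))
  refine ⟨δ, hδ, fun q hq hqp => ?_⟩
  have hsmall : |oneSidedSecondDiff f p q - ((q - p) / 3) ^ 2 * secondDeriv a b f p| ≤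
      |secondDeriv a b f p| / 18 * (q - p) ^ 2 := by
    simpa using hball ⟨hqp, hq⟩
  have hmain : |((q - p) / 3) ^ 2 * secondDeriv a b f p| =
      |secondDeriv a b f p| / 9 * (q - p) ^ 2 := by
    rw [abs_mul, abs_of_nonneg (sq_nonneg _)]
    ring
  rw [abs_sub_comm] at hsmall
  linarith [abs_sub_abs_le_abs_sub (((q - p) / 3) ^ 2 * secondDeriv a b f p)
    (oneSidedSecondDiff f p q)]

lemma abs_oneSidedSecondDiff_sub_le {E : ℝ} (hsp : s p = f p) (hsq : s q = f q)
    (hE : ∀ t ∈ uIcc p q, |s t - f t| ≤ E) :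
    |oneSidedSecondDiff s p q - oneSidedSecondDiff f p q| ≤ 9 * E := by
  have hnode {θ : ℝ} (hθ : θ ∈ Icc (0 : ℝ) 1) : |s (lineMap p q θ) - f (lineMap p q θ)| ≤ E :=
    hE _ ((convex_uIcc p q).lineMap_mem left_mem_uIcc right_mem_uIcc hθ)
  have hthird := abs_le.1 (hnode (θ := 1 / 3) (by norm_num))
  have htwoThirds := abs_le.1 (hnode (θ := 2 / 3) (by norm_num))
  rw [oneSidedSecondDiff, oneSidedSecondDiff, hsp, hsq]
  exact abs_le.2 ⟨by linarith, by linarith⟩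

end OneSidedSecondDiff

namespace IsCubicSpline

variable {a b p q : ℝ} {n : ℕ} {x : ℕ → ℝ} {f s : ℝ → ℝ}

lemma oneSidedSecondDiff_eq (hs : IsCubicSpline a b n x s) (hx : IsMesh a b n x) {i : ℕ}
    (hi : i < n) (hp : p ∈ Icc (x i) (x (i + 1))) (hq : q ∈ Icc (x i) (x (i + 1))) :
    oneSidedSecondDiff s p q = ((q - p) / 3) ^ 2 * secondDeriv a b s p := by
  obtain ⟨P, hP, hsP⟩ := hs.cubic i hi
  have hnode {θ : ℝ} (hθ : θ ∈ Icc (0 : ℝ) 1) := hsP _ ((convex_Icc _ _).lineMap_mem hp hq hθ)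
  rw [secondDeriv_eq_of_eqOn_polynomial (hx.lt i hi) (hx.Icc_subset hi) hs.contDiffOn hsP hp,
    ← oneSidedSecondDiff_eval hP, oneSidedSecondDiff, oneSidedSecondDiff, hsP p hp, hsP q hq,
    hnode (by norm_num), hnode (by norm_num)]

lemma abs_oneSidedSecondDiff_le_maxError (hs : IsCubicSpline a b n x s) (hx : IsMesh a b n x)
    (hf : ContinuousOn f (Icc a b)) {i : ℕ} (hi : i < n) (hp : p ∈ Icc (x i) (x (i + 1)))
    (hq : q ∈ Icc (x i) (x (i + 1))) (hsp : s p = f p) (hsq : s q = f q)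
    (hsecond : secondDeriv a b s p = 0) :
    |oneSidedSecondDiff f p q| ≤ 9 * maxError (x i) (x (i + 1)) f s := by
  have hsub := hx.Icc_subset hi
  have hdiff := abs_oneSidedSecondDiff_sub_le hsp hsq fun t ht =>
    abs_sub_le_maxError (hs.contDiffOn.continuousOn.mono hsub) (hf.mono hsub)
      (uIcc_subset_Icc hp hq ht)
  rwa [hs.oneSidedSecondDiff_eq hx hi hp hq, hsecond, mul_zero, zero_sub, abs_neg] at hdiff

end IsCubicSpline

lemma exists_mul_sq_le_maxError_end {a b : ℝ} {f : ℝ → ℝ} (hab : a < b)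
    (hf : ContDiffOn ℝ 2 f (Icc a b)) :
    ∃ h₀ > 0, ∀ (n : ℕ) (x : ℕ → ℝ) (s : ℝ → ℝ), IsMesh a b n x → IsNaturalSpline a b n x f s →
      meshSize n x ≤ h₀ →
      |secondDeriv a b f a| / 162 * (x 1 - x 0) ^ 2 ≤ maxError (x 0) (x 1) f s ∧
      |secondDeriv a b f b| / 162 * (x n - x (n - 1)) ^ 2 ≤ maxError (x (n - 1)) (x n) f s := by
  obtain ⟨δ, hδ, hleft⟩ := exists_mul_sq_le_abs_oneSidedSecondDiff hf (left_mem_Icc.2 hab.le)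
  obtain ⟨δ', hδ', hright⟩ := exists_mul_sq_le_abs_oneSidedSecondDiff hf (right_mem_Icc.2 hab.le)
  refine ⟨min δ δ' / 2, by positivity, fun n x s hx hs hsize => ?_⟩
  obtain ⟨m, rfl⟩ := Nat.exists_eq_add_one.2 (hx.pos hab)
  have hlt := hx.lt 0 m.succ_pos
  have hlt' := hx.lt m m.lt_succ_self
  have hsmall {i : ℕ} (hi : i < m + 1) : x (i + 1) - x i < min δ δ' :=
    ((sub_le_meshSize x hi).trans hsize).trans_lt (half_lt_self (lt_min hδ hδ'))
  obtain rfl := hx.left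
  obtain rfl := hx.right
  constructor
  · have hlower := hleft (x 1) (hx.mem_Icc (by omega))
      (by rw [abs_of_pos (sub_pos.2 hlt)]; exact (hsmall m.succ_pos).trans_le (min_le_left _ _))
    have hupper := hs.spline.abs_oneSidedSecondDiff_le_maxError hx hf.continuousOn m.succ_pos
      (left_mem_Icc.2 hlt.le) (right_mem_Icc.2 hlt.le) (hs.interp 0 (by omega))
      (hs.interp 1 (by omega)) hs.natural_left
    rw [zero_add] at hupper
    linarith
  · have hlower := hright (x m) (hx.mem_Icc m.le_succ)
      (by rw [abs_sub_comm, abs_of_pos (sub_pos.2 hlt')]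
          exact (hsmall m.lt_succ_self).trans_le (min_le_right _ _))
    have hupper := hs.spline.abs_oneSidedSecondDiff_le_maxError hx hf.continuousOn m.lt_succ_self
      (right_mem_Icc.2 hlt'.le) (left_mem_Icc.2 hlt'.le) (hs.interp (m + 1) le_rfl)
      (hs.interp m m.le_succ) hs.natural_right
    rw [Nat.add_sub_cancel]
    linarith [sub_sq_comm (x m) (x (m + 1))]

lemma exists_isMesh_end_gaps_eq {a b h : ℝ} (hh : 0 < h) (hlt : 3 * h < b - a) :
    ∃ (n : ℕ) (x : ℕ → ℝ), 4 ≤ n ∧ IsMesh a b n x ∧ meshSize n x = h ∧ x 1 - x 0 = h ∧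
      x n - x (n - 1) = h := by
  obtain ⟨N, hN, hNle, hNlt⟩ : ∃ N : ℕ, 3 ≤ N ∧ b - h ≤ a + N * h ∧ ∀ i < N, a + i * h < b - h := by
    refine ⟨⌈(b - h - a) / h⌉₊, Nat.lt_ceil.2 ?_, ?_, fun i hi => ?_⟩
    · rw [lt_div_iff₀ hh]
      push_cast
      linarith
    · linarith [(div_le_iff₀ hh).1 (Nat.le_ceil ((b - h - a) / h))]
    · linarith [(lt_div_iff₀ hh).1 (Nat.lt_ceil.1 hi)]
  set x : ℕ → ℝ := fun i => if i ≤ N then min (a + i * h) (b - h) else b with hx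
  have hx_lt {i : ℕ} (hi : i < N) : x i = a + i * h := by
    simp only [hx, hi.le, if_true, min_eq_left (hNlt i hi).le]
  have hxN : x N = b - h := by simp only [hx, le_rfl, if_true, min_eq_right hNle]
  have hx_last : x (N + 1) = b := if_neg (by omega)
  have hx_left : x 0 = a := by simp [hx_lt (by omega : 0 < N)]
  have hfirst : x (0 + 1) - x 0 = h := by simp [hx_left, hx_lt (by omega : 1 < N)]
  have hgap : ∀ i < N + 1, 0 < x (i + 1) - x i ∧ x (i + 1) - x i ≤ h := fun i hi => by
    rcases Nat.lt_succ_iff_lt_or_eq.1 hi with hi | rfl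
    · have hsucc : x (i + 1) = min (a + (i + 1) * h) (b - h) := by
        simp only [hx, Nat.succ_le_iff.2 hi, if_true, Nat.cast_succ]
      rw [hsucc, hx_lt hi, sub_pos, sub_le_iff_le_add]
      exact ⟨lt_min (by linarith) (hNlt i hi), (min_le_left _ _).trans (by linarith)⟩
    · rw [hx_last, hxN]
      constructor <;> linarith
  refine ⟨N + 1, x, by omega, ⟨hx_left, hx_last, fun i hi => sub_pos.1 (hgap i hi).1⟩,
    le_antisymm (meshSize_le hh.le fun i hi => (hgap i hi).2) ?_, hfirst, ?_⟩
  · exact hfirst.ge.trans (sub_le_meshSize x N.succ_pos)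
  · rw [Nat.add_sub_cancel, hx_last, hxN, sub_sub_cancel]


section WorstError

variable {a b h : ℝ} {f : ℝ → ℝ}

lemma exists_maxError_le (hab : a < b) (hf : ContDiffOn ℝ 2 f (Icc a b)) :
    ∃ C > 0, ∀ (n : ℕ) (x : ℕ → ℝ) (s : ℝ → ℝ), IsMesh a b n x → IsNaturalSpline a b n x f s →
      maxError a b f s ≤ C * meshSize n x ^ 2 := by
  obtain ⟨K, hK, hfK⟩ := exists_forall_abs_secondDeriv_le hab hf
  exact ⟨7 / 4 * K, by positivity, fun n x s hx hs =>
    maxError_le (by positivity) fun t ht => hs.abs_sub_le hab hx hf hfK ht⟩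

lemma exists_mul_sq_le_maxError (hab : a < b) (hf : ContDiffOn ℝ 2 f (Icc a b)) :
    ∃ c > 0, ∃ h₀ > 0, ∀ (n : ℕ) (x : ℕ → ℝ) (s : ℝ → ℝ), IsMesh a b n x →
      IsNaturalSpline a b n x f s → meshSize n x ≤ h₀ →
      (secondDeriv a b f a ≠ 0 → c * (x 1 - x 0) ^ 2 ≤ maxError (x 0) (x 1) f s) ∧
      (secondDeriv a b f b ≠ 0 → c * (x n - x (n - 1)) ^ 2 ≤ maxError (x (n - 1)) (x n) f s) := by
  obtain ⟨h₀, hh₀, hend⟩ := exists_mul_sq_le_maxError_end hab hf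
  have hconst (z : ℝ) : ∃ c > 0, z ≠ 0 → c ≤ |z| / 162 := by
    rcases eq_or_ne z 0 with rfl | hz
    · exact ⟨1, one_pos, fun hz => absurd rfl hz⟩
    · exact ⟨|z| / 162, by positivity, fun _ => le_rfl⟩
  obtain ⟨c, hc, hca⟩ := hconst (secondDeriv a b f a)
  obtain ⟨c', hc', hcb⟩ := hconst (secondDeriv a b f b)
  refine ⟨min c c', lt_min hc hc', h₀, hh₀, fun n x s hx hs hsize => ⟨fun ha => ?_, fun hb => ?_⟩⟩
  · refine le_trans ?_ (hend n x s hx hs hsize).1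
    gcongr
    exact (min_le_left c c').trans (hca ha)
  · refine le_trans ?_ (hend n x s hx hs hsize).2
    gcongr
    exact (min_le_right c c').trans (hcb hb)

lemma worstError_nonneg (a b : ℝ) (f : ℝ → ℝ) (h : ℝ) : 0 ≤ worstError a b f h :=
  Real.sSup_nonneg <| by
    rintro _ ⟨n, x, s, -, -, -, -, rfl⟩
    exact maxError_nonneg a b f s

lemma worstError_le {B : ℝ} (hB : 0 ≤ B) (hle : ∀ (n : ℕ) (x : ℕ → ℝ) (s : ℝ → ℝ),
      IsMesh a b n x → meshSize n x = h → IsNaturalSpline a b n x f s → maxError a b f s ≤ B) :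
    worstError a b f h ≤ B :=
  Real.sSup_le (by
    rintro _ ⟨n, x, s, -, hx, hsize, hs, rfl⟩
    exact hle n x s hx hsize hs) hB

lemma maxError_le_worstError (hab : a < b) (hf : ContDiffOn ℝ 2 f (Icc a b)) {n : ℕ} {x : ℕ → ℝ}
    {s : ℝ → ℝ} (hn : 4 ≤ n) (hx : IsMesh a b n x) (hs : IsNaturalSpline a b n x f s) :
    maxError a b f s ≤ worstError a b f (meshSize n x) := by
  obtain ⟨C, -, hC⟩ := exists_maxError_le hab hf
  refine le_csSup ⟨C * meshSize n x ^ 2, ?_⟩ ⟨n, x, s, hn, hx, rfl, hs, rfl⟩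
  rintro _ ⟨n', x', s', -, hx', hsize, hs', rfl⟩
  exact hsize ▸ hC n' x' s' hx' hs'

lemma exists_mul_sq_le_worstError (hab : a < b) (hf : ContDiffOn ℝ 2 f (Icc a b)) :
    ∃ h₀ > 0, ∀ h ∈ Ioo 0 h₀, (|secondDeriv a b f a| + |secondDeriv a b f b|) / 324 * h ^ 2 ≤
      worstError a b f h := by
  obtain ⟨h₀, hh₀, hend⟩ := exists_mul_sq_le_maxError_end hab hf
  refine ⟨min h₀ ((b - a) / 3), lt_min hh₀ (by linarith), fun h ⟨hpos, hlt⟩ => ?_⟩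
  obtain ⟨hlt₀, hlt_third⟩ := lt_min_iff.1 hlt
  obtain ⟨n, x, hn, hx, rfl, hfirst, hlast⟩ :=
    exists_isMesh_end_gaps_eq hpos (by linarith : 3 * h < b - a)
  obtain ⟨s, hs⟩ := exists_isNaturalSpline hab hx f
  obtain ⟨hleft, hright⟩ := hend n x s hx hs hlt₀.le
  rw [hfirst] at hleft
  rw [hlast] at hright
  have hmono {i j : ℕ} (hi : i ≤ n) (hj : j ≤ n) : maxError (x i) (x j) f s ≤
      worstError a b f (meshSize n x) :=
    (maxError_mono hs.spline.contDiffOn.continuousOn hf.continuousOn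
      (Icc_subset_Icc (hx.mem_Icc hi).1 (hx.mem_Icc hj).2)).trans
      (maxError_le_worstError hab hf hn hx hs)
  linarith [hmono (i := 0) (j := 1) (by omega) (by omega), hmono (n.sub_le 1) le_rfl]

theorem worstError_isTheta (hab : a < b) (hf : ContDiffOn ℝ 2 f (Icc a b))
    (hne : 0 < |secondDeriv a b f a| + |secondDeriv a b f b|) :
    worstError a b f =Θ[𝓝[>] 0] fun h => h ^ 2 := by
  obtain ⟨C, hC, hupper⟩ := exists_maxError_le hab hf
  obtain ⟨h₀, hh₀, hlower⟩ := exists_mul_sq_le_worstError hab hf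
  have hnorm (h : ℝ) : ‖worstError a b f h‖ = worstError a b f h :=
    Real.norm_of_nonneg (worstError_nonneg a b f h)
  have hnorm_sq (h : ℝ) : ‖h ^ 2‖ = h ^ 2 := Real.norm_of_nonneg (sq_nonneg h)
  constructor
  · refine IsBigO.of_bound C (Eventually.of_forall fun h => ?_)
    rw [hnorm, hnorm_sq]
    exact worstError_le (by positivity) fun n x s hx hsize hs => hsize ▸ hupper n x s hx hs
  · refine IsBigO.of_bound ((|secondDeriv a b f a| + |secondDeriv a b f b|) / 324)⁻¹ ?_
    filter_upwards [Ioo_mem_nhdsGT hh₀] with h hh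
    rw [hnorm, hnorm_sq, ← div_eq_inv_mul, le_div_iff₀' (by positivity)]
    exact hlower h hh

end WorstError

theorem corollary1_general {a b : ℝ} (hab : a < b) {f : ℝ → ℝ} (hf : ContDiffOn ℝ 2 f (Icc a b))
    (hne : 0 < |secondDeriv a b f a| + |secondDeriv a b f b|) :
    (∀ (n : ℕ) (x : ℕ → ℝ), IsMesh a b n x →
      ∃ s : ℝ → ℝ, IsNaturalSpline a b n x f s ∧
        ∀ s' : ℝ → ℝ, IsNaturalSpline a b n x f s' → EqOn s' s (Icc a b)) ∧
    (∃ C : ℝ, 0 < C ∧ ∀ (n : ℕ) (x : ℕ → ℝ) (s : ℝ → ℝ), IsMesh a b n x →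
      IsNaturalSpline a b n x f s → maxError a b f s ≤ C * meshSize n x ^ 2) ∧
    (∃ c h₀ : ℝ, 0 < c ∧ 0 < h₀ ∧ ∀ (n : ℕ) (x : ℕ → ℝ) (s : ℝ → ℝ), IsMesh a b n x →
      IsNaturalSpline a b n x f s → meshSize n x ≤ h₀ →
      (secondDeriv a b f a ≠ 0 →
        c * (x 1 - x 0) ^ 2 ≤ maxError (x 0) (x 1) f s) ∧
      (secondDeriv a b f b ≠ 0 →
        c * (x n - x (n - 1)) ^ 2 ≤ maxError (x (n - 1)) (x n) f s)) ∧
    (worstError a b f =Θ[𝓝[>] (0 : ℝ)] fun h : ℝ => h ^ 2) := by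
  refine ⟨fun n x hx => ?_, exists_maxError_le hab hf, ?_, worstError_isTheta hab hf hne⟩
  · obtain ⟨s, hs⟩ := exists_isNaturalSpline hab hx f
    exact ⟨s, hs, fun s' hs' => hs'.eqOn hs hab hx⟩
  · obtain ⟨c, hc, h₀, hh₀, hlower⟩ := exists_mul_sq_le_maxError hab hf
    exact ⟨c, h₀, hc, hh₀, hlower⟩

theorem corollary1 (a b : ℝ) (hab : a < b) (f : ℝ → ℝ)
    (hf : ContDiffOn ℝ 4 f (Icc a b))
    (hne : 0 < |secondDeriv a b f a| + |secondDeriv a b f b|) :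
    -- the natural spline exists and is unique on `[a, b]`
    (∀ (n : ℕ) (x : ℕ → ℝ), 4 ≤ n → IsMesh a b n x →
      ∃ s : ℝ → ℝ, IsNaturalSpline a b n x f s ∧
        ∀ s' : ℝ → ℝ, IsNaturalSpline a b n x f s' → EqOn s' s (Icc a b)) ∧
    -- upper bound of order `h ^ 2` on every mesh
    (∃ C : ℝ, 0 < C ∧ ∀ (n : ℕ) (x : ℕ → ℝ) (s : ℝ → ℝ), 4 ≤ n → IsMesh a b n x →
      IsNaturalSpline a b n x f s → maxError a b f s ≤ C * meshSize n x ^ 2) ∧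
    -- lower bound on every fine mesh, of second order in the length of the end interval
    (∃ c h₀ : ℝ, 0 < c ∧ 0 < h₀ ∧ ∀ (n : ℕ) (x : ℕ → ℝ) (s : ℝ → ℝ), 4 ≤ n → IsMesh a b n x →
      IsNaturalSpline a b n x f s → meshSize n x ≤ h₀ →
      (secondDeriv a b f a ≠ 0 →
        c * (x 1 - x 0) ^ 2 ≤ maxError (x 0) (x 1) f s) ∧
      (secondDeriv a b f b ≠ 0 →
        c * (x n - x (n - 1)) ^ 2 ≤ maxError (x (n - 1)) (x n) f s)) ∧
    -- the error, in the worst case over meshes of size `h`, is of the exact order `h ^ 2`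
    (worstError a b f =Θ[𝓝[>] (0 : ℝ)] fun h : ℝ => h ^ 2) := by
  obtain ⟨hexists, ⟨C, hC, hupper⟩, ⟨c, h₀, hc, hh₀, hlower⟩, htheta⟩ :=
    corollary1_general hab (hf.of_le (by norm_num)) hne
  exact ⟨fun n x _ => hexists n x, ⟨C, hC, fun n x s _ => hupper n x s⟩,
    ⟨c, h₀, hc, hh₀, fun n x s _ => hlower n x s⟩, htheta⟩
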